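/- Let $L\ge 2$ and let $d_0,\dots,d_L$ be natural numbers with $d_i\ge\min\{d_0,d_L\}$ for all $0\le i\le L$. Let $M^\natural\in\mathbb R^{d_L\times d_0}$ and $\lambda>0$, and put $q:=2/L$. For $\mathbf w=(W_1,\dots,W_L)$ with $W_i\in\mathbb R^{d_i\times d_{i-1}}$ consider the regularized deep matrix factorization loss $$\mathcal L(\mathbf w):=\|M^\natural-W_LW_{L-1}\cdots W_1\|_F^2+\frac{\lambda}{L}\sum_{i=1}^L\|W_i\|_F^2,$$ where $\|\cdot\|_F$ is the Frobenius norm, and let $\Omega:=\operatorname{arg\,min}_{\mathbf w}\mathcal L(\mathbf w)$ be its set of global minimizers. Let $\sigma(M^\natural)\in\mathbb R^{\min\{d_0,d_L\}}$ be the vector of singular values of $M^\natural$ and $\|\cdot\|_\infty$ the maximum norm. Suppose that $$\lambda>\left(\frac{\|\sigma(M^\natural)\|_\infty}{\left(1-\frac q2\right)(1-q)^{\frac{q-1}{2-q}}}\right)^{2-q},$$ where, for $L=2$ (so $q=1$), $(1-q)^{\frac{q-1}{2-q}}=0^0$ is read as $1$. Then $W_L^*W_{L-1}^*\cdots W_1^*=0$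 for every $\mathbf w^*=(W_1^*,\dots,W_L^*)\in\Omega$. -/

import Mathlib

noncomputable section

namespace DeepMF

/-- A parameter vector of a factorization of depth `L` with layer widths `d 0, …, d L`, given as
the family of its layers. The index `i : Fin L` stands for layer number `i + 1`, a
`d (i + 1) × d i` real matrix. -/
abbrev Params (d : ℕ → ℕ) (L : ℕ) : Type :=
  (i : Fin L) → Matrix (Fin (d (i + 1))) (Fin (d i)) ℝ

/-- The end-to-end product `W_L * W_{L-1} * ⋯ * W_1` (the identity matrix when `L = 0`). -/
def endToEnd (d : ℕ → ℕ) : (L : ℕ) → Params d L → Matrix (Fin (d L)) (Fin (d 0)) ℝ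
  | 0, _ => 1
  | L + 1, W =>
    HMul.hMul (α := Matrix (Fin (d (L + 1))) (Fin (d L)) ℝ) (W (Fin.last L))
      (endToEnd d L (fun i => W i.castSucc))

/-- The vector `σ(X) ∈ ℝ^{min(m,n)}` of singular values of `X`, in non-increasing order. -/
def sigma {m n : ℕ} (X : Matrix (Fin m) (Fin n) ℝ) : Fin (min m n) → ℝ :=
  fun i => (Matrix.toEuclideanLin X).singularValues i

section Loss

open scoped Matrix.Norms.Frobenius

/-- The regularized loss
`‖M - W_L ⋯ W_1‖_F ^ 2 + (lam / L) * ∑ i, ‖W_i‖_F ^ 2`; all norms here are Frobenius norms. -/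
def loss {d : ℕ → ℕ} {L : ℕ} (M : Matrix (Fin (d L)) (Fin (d 0)) ℝ) (lam : ℝ)
    (W : Params d L) : ℝ :=
  ‖M - endToEnd d L W‖ ^ 2 + lam / (L : ℝ) * ∑ i : Fin L, ‖W i‖ ^ 2

end Loss

/-- The set of global minimizers of the regularized loss. -/
def minimizers {d : ℕ → ℕ} {L : ℕ} (M : Matrix (Fin (d L)) (Fin (d 0)) ℝ) (lam : ℝ) :
    Set (Params d L) :=
  {W | ∀ W' : Params d L, loss M lam W ≤ loss M lam W'}

end DeepMF

end

namespace DeepMF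

open Matrix

section Frobenius

open scoped Matrix.Norms.Frobenius

/-! Inserting invertible matrices and their inverses between consecutive layers keeps the product,
so a minimizer is stationary for the norm penalty along these directions. This forces equal Gram
matrices where layers meet (`balanced_of_mem_minimizers`). Hence, with `A = W_L W_Lᵀ` and `X` the
product, `X Xᵀ = A ^ L` and every layer has squared norm `tr A`. In an eigenbasis `b_j` of `A`, the
numbers `s_j = ‖Xᵀ b_j‖` satisfy `tr A = ∑ s_j ^ q`, while `tr (M Xᵀ) ≤ ‖σ(M)‖ ∑ s_j`. Comparing the
loss with its value at zero weights gives `∑ (s_j² - 2‖σ(M)‖ s_j + lam s_j ^ q) ≤ 0`. Above the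
threshold each summand with `s_j > 0` is positive (`scalar_pos`), so all `s_j` vanish and `X = 0`.
-/

theorem frobenius_norm_sq {m n : Type*} [Fintype m] [Fintype n] (A : Matrix m n ℝ) :
    ‖A‖ ^ 2 = ∑ i, ∑ j, A i j ^ 2 := by
  rw [Matrix.frobenius_norm_def, ← Real.sqrt_eq_rpow, Real.sq_sqrt (by positivity)]
  simp

theorem frobenius_norm_sq_eq_trace {m n : Type*} [Fintype m] [Fintype n] (A : Matrix m n ℝ) :
    ‖A‖ ^ 2 = (A * Aᵀ).trace := by
  rw [frobenius_norm_sq]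
  simp [Matrix.trace, Matrix.mul_apply, sq]

theorem frobenius_norm_sub_sq {m n : Type*} [Fintype m] [Fintype n] (A B : Matrix m n ℝ) :
    ‖A - B‖ ^ 2 = ‖A‖ ^ 2 - 2 * (A * Bᵀ).trace + (B * Bᵀ).trace := by
  have h : (B * Aᵀ).trace = (A * Bᵀ).trace := by
    rw [← Matrix.trace_transpose, Matrix.transpose_mul, Matrix.transpose_transpose]
  rw [frobenius_norm_sq_eq_trace, frobenius_norm_sq_eq_trace, Matrix.transpose_sub, Matrix.sub_mul,
    Matrix.mul_sub, Matrix.mul_sub]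
  simp only [Matrix.trace_sub, h]
  ring

end Frobenius

/-! ### Entrywise derivatives of matrix-valued curves -/

theorem hasDerivAt_mul_apply {l m n : Type*} [Fintype m] {A : ℝ → Matrix l m ℝ}
    {B : ℝ → Matrix m n ℝ} {A' : Matrix l m ℝ} {B' : Matrix m n ℝ} {t : ℝ}
    (hA : ∀ i j, HasDerivAt (fun s => A s i j) (A' i j) t)
    (hB : ∀ i j, HasDerivAt (fun s => B s i j) (B' i j) t) (i : l) (j : n) :
    HasDerivAt (fun s => (A s * B s) i j) ((A' * B t + A t * B') i j) t := by
  simp only [Matrix.mul_apply, Matrix.add_apply, ← Finset.sum_add_distrib]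
  exact HasDerivAt.fun_sum fun k _ => (hA i k).mul (hB k j)

section Exp

open scoped Matrix.Norms.Operator

theorem hasDerivAt_exp_smul_apply {n : Type*} [Fintype n] [DecidableEq n] (S : Matrix n n ℝ)
    (i j : n) : HasDerivAt (fun t : ℝ => NormedSpace.exp (t • S) i j) (S i j) 0 := by
  have h := hasDerivAt_exp_smul_const (𝕂 := ℝ) S (0 : ℝ)
  simp only [zero_smul, NormedSpace.exp_zero, one_mul] at h
  exact hasDerivAt_pi.1 (hasDerivAt_pi.1 h i) j

end Exp

/-! ### Gauge symmetry of the product and balancedness of minimizers -/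

section Gauge

open scoped Matrix.Norms.Frobenius

/-- Trace form lets the variations of neighbouring layers combine: a generator at an interior
interface gets paired with the difference of the two Gram matrices meeting there. -/
theorem hasDerivAt_norm_sq_exp_conj {m n : Type*} [Fintype m] [Fintype n] [DecidableEq m]
    [DecidableEq n] (S : Matrix m m ℝ) (T : Matrix n n ℝ) (W : Matrix m n ℝ) :
    HasDerivAt (fun t : ℝ => ‖NormedSpace.exp (t • S) * W * NormedSpace.exp (t • -T)‖ ^ 2)
      (2 * (S * (W * Wᵀ)).trace - 2 * (T * (Wᵀ * W)).trace) 0 := by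
  have h := hasDerivAt_mul_apply (t := 0)
    (hasDerivAt_mul_apply (B := fun _ => W) (B' := 0) (hasDerivAt_exp_smul_apply S)
      (fun i j => hasDerivAt_const _ _)) (hasDerivAt_exp_smul_apply (-T))
  simp only [zero_smul, NormedSpace.exp_zero, Matrix.mul_zero, Matrix.one_mul, add_zero,
    Matrix.mul_one, Matrix.mul_neg] at h
  simp only [frobenius_norm_sq]
  have h2 := HasDerivAt.fun_sum (u := Finset.univ) fun i _ =>
    HasDerivAt.fun_sum (u := Finset.univ) fun j _ => (h i j).fun_pow 2
  refine h2.congr_deriv ?_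
  have e1 : (S * (W * Wᵀ)).trace = ∑ i, ∑ j, W i j * (S * W) i j := by
    rw [← Matrix.mul_assoc]
    simp only [Matrix.trace, Matrix.diag, Matrix.mul_apply (M := S * W), Matrix.transpose_apply,
      mul_comm]
  have e2 : (T * (Wᵀ * W)).trace = ∑ i, ∑ j, W i j * (W * T) i j := by
    rw [Matrix.trace_mul_comm, Matrix.mul_assoc, Matrix.trace_mul_comm]
    simp only [Matrix.trace, Matrix.diag, Matrix.mul_apply (M := W * T), Matrix.transpose_apply,
      mul_comm]
  rw [e1, e2]
  simp only [Finset.mul_sum, ← Finset.sum_sub_distrib]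
  refine Finset.sum_congr rfl fun i _ => Finset.sum_congr rfl fun j _ => ?_
  simp
  ring

/-- Changing the bases of all layers changes the product only at its two ends. -/
theorem endToEnd_conj (d : ℕ → ℕ) (G H : (i : ℕ) → Matrix (Fin (d i)) (Fin (d i)) ℝ)
    (hHG : ∀ i, H i * G i = 1) (L : ℕ) (W : Params d L) :
    endToEnd d L (fun i => G (i + 1) * W i * H i) * G 0 = G L * endToEnd d L W := by
  induction L with
  | zero => simp [endToEnd]
  | succ L ih =>
    simp only [endToEnd]
    have := ih fun i => W i.castSucc
    simp only [Fin.val_castSucc, Fin.val_last] at this ⊢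
    erw [Matrix.mul_assoc, this]
    rw [← Matrix.mul_assoc, Matrix.mul_assoc _ (H L), hHG L, Matrix.mul_one, Matrix.mul_assoc]

end Gauge

/-- The Gram matrices of consecutive layers of a minimizer agree. -/
theorem balanced_of_mem_minimizers {d : ℕ → ℕ} {L : ℕ} {M : Matrix (Fin (d L)) (Fin (d 0)) ℝ}
    {lam : ℝ} (hlam : 0 < lam) {W : Params d L} (hW : W ∈ minimizers M lam) (k : ℕ)
    (hk : k + 1 < L) :
    W ⟨k, Nat.lt_of_succ_lt hk⟩ * (W ⟨k, Nat.lt_of_succ_lt hk⟩)ᵀ = (W ⟨k + 1, hk⟩)ᵀ * W ⟨k + 1, hk⟩ := by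
  set D : Matrix (Fin (d (k + 1))) (Fin (d (k + 1))) ℝ :=
    W ⟨k, Nat.lt_of_succ_lt hk⟩ * (W ⟨k, Nat.lt_of_succ_lt hk⟩)ᵀ - (W ⟨k + 1, hk⟩)ᵀ * W ⟨k + 1, hk⟩ with hD
  -- Only the interface between the two layers is moved. It is interior, so both ends of the product
  -- stay fixed, and taking `D` itself as generator turns the derivative into `2 tr (D * D)`.
  let S : (i : ℕ) → Matrix (Fin (d i)) (Fin (d i)) ℝ := Pi.single (k + 1) D
  have hS : ∀ i, i ≠ k + 1 → S i = 0 := fun i hi => Pi.single_eq_of_ne (M := fun i => Matrix (Fin (d i)) (Fin (d i)) ℝ) hi D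
  have hSk : S (k + 1) = D := Pi.single_eq_same _ _
  let V : ℝ → Params d L := fun t i =>
    NormedSpace.exp (t • S (i + 1)) * W i * NormedSpace.exp (t • -S i)
  have hprod : ∀ t, endToEnd d L (V t) = endToEnd d L W := by
    intro t
    have h := endToEnd_conj d (fun i => NormedSpace.exp (t • S i))
      (fun i => NormedSpace.exp (t • -S i)) (fun i => by
        rw [smul_neg, ← Matrix.exp_add_of_commute _ _ (Commute.refl (t • S i)).neg_left]
        simp) L W
    simpa only [hS 0 (by omega), hS L (by omega), smul_zero, NormedSpace.exp_zero, Matrix.mul_one,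
      Matrix.one_mul] using h
  have hderiv := HasDerivAt.fun_sum (u := Finset.univ) fun (i : Fin L) _ =>
    hasDerivAt_norm_sq_exp_conj (S (i + 1)) (S i) (W i)
  have hmin := IsLocalMin.hasDerivAt_eq_zero (Filter.Eventually.of_forall fun t => by
    have h := hW (V t)
    simp only [loss, hprod t] at h
    have h' := le_of_mul_le_mul_left (le_of_add_le_add_left h)
      (div_pos hlam (Nat.cast_pos.2 (by omega : 0 < L)))
    simpa [V] using h') hderiv
  rw [Finset.sum_sub_distrib, Finset.sum_eq_single (⟨k, Nat.lt_of_succ_lt hk⟩ : Fin L),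
    Finset.sum_eq_single (⟨k + 1, hk⟩ : Fin L)] at hmin
  · simp only [hSk] at hmin
    have h0 : (D * D).trace = 0 := by
      nth_rw 2 [hD]
      rw [Matrix.mul_sub, Matrix.trace_sub]
      linarith
    -- `D` is symmetric, so `tr (D * D)` is its squared Frobenius norm.
    have hDT : D * D = Dᵀ * D := by simp [hD]
    have h1 : D = 0 := by
      rw [hDT] at h0
      exact Matrix.trace_conjTranspose_mul_self_eq_zero_iff.1 (by simpa using h0)
    exact sub_eq_zero.1 h1
  · intro i _ hi
    rw [hS i (fun h => hi (Fin.ext h))]; simp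
  · simp
  · intro i _ hi
    rw [hS (i + 1) (fun h => hi (Fin.ext (by simpa using h)))]; simp
  · simp

/-! ### The loss at balanced weights -/

theorem mul_transpose_mul_pow_mul {m n : Type*} [Fintype m] [Fintype n] [DecidableEq m]
    [DecidableEq n] (B : Matrix m n ℝ) (k : ℕ) :
    B * (Bᵀ * B) ^ k * Bᵀ = (B * Bᵀ) ^ (k + 1) := by
  induction k with
  | zero => simp
  | succ k ih => rw [pow_succ' (B * Bᵀ), ← ih, pow_succ']; simp only [Matrix.mul_assoc]

/-- Balancedness rewrites the Gram power of the shorter product through `BᵀB`, with `B` the new last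
layer; sandwiching it between `B` and `Bᵀ` raises the exponent by one. -/
theorem endToEnd_mul_transpose_of_balanced (d : ℕ → ℕ) (L : ℕ) (W : Params d (L + 1))
    (hb : ∀ (k : ℕ) (hk : k + 1 < L + 1),
      W ⟨k, Nat.lt_of_succ_lt hk⟩ * (W ⟨k, Nat.lt_of_succ_lt hk⟩)ᵀ = (W ⟨k + 1, hk⟩)ᵀ * W ⟨k + 1, hk⟩) :
    endToEnd d (L + 1) W * (endToEnd d (L + 1) W)ᵀ =
      (W (Fin.last L) * (W (Fin.last L))ᵀ) ^ (L + 1) := by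
  induction L with
  | zero => simp [endToEnd]
  | succ L ih =>
    have h1 := ih (fun i => W i.castSucc) fun k hk => hb k (by omega)
    have h2 : W (Fin.last L).castSucc * (W (Fin.last L).castSucc)ᵀ =
        (W (Fin.last (L + 1)))ᵀ * W (Fin.last (L + 1)) := hb L (by omega)
    rw [h2] at h1
    rw [← mul_transpose_mul_pow_mul, ← h1, endToEnd, Matrix.transpose_mul]
    simp only [Matrix.mul_assoc]

open scoped Matrix.Norms.Frobenius in
theorem norm_sq_eq_of_balanced (d : ℕ → ℕ) (L : ℕ) (W : Params d (L + 1))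
    (hb : ∀ (k : ℕ) (hk : k + 1 < L + 1),
      W ⟨k, Nat.lt_of_succ_lt hk⟩ * (W ⟨k, Nat.lt_of_succ_lt hk⟩)ᵀ = (W ⟨k + 1, hk⟩)ᵀ * W ⟨k + 1, hk⟩)
    (i : Fin (L + 1)) : ‖W i‖ ^ 2 = (W (Fin.last L) * (W (Fin.last L))ᵀ).trace := by
  induction i using Fin.reverseInduction with
  | last => rw [frobenius_norm_sq_eq_trace]
  | cast i ih =>
    rw [← ih, frobenius_norm_sq_eq_trace, frobenius_norm_sq_eq_trace, Matrix.trace_mul_comm (W i.succ)]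
    exact congrArg Matrix.trace (hb i (by omega))

section Loss

open scoped Matrix.Norms.Frobenius

theorem loss_zero {d : ℕ → ℕ} {L : ℕ} (M : Matrix (Fin (d (L + 1))) (Fin (d 0)) ℝ) (lam : ℝ) :
    loss M lam (0 : Params d (L + 1)) = ‖M‖ ^ 2 := by
  have hz : endToEnd d (L + 1) 0 = 0 := by simp [endToEnd]
  rw [loss, hz]
  simp only [sub_zero, Pi.zero_apply, norm_zero]
  simp

theorem loss_eq_of_balanced {d : ℕ → ℕ} {L : ℕ} (M : Matrix (Fin (d (L + 1))) (Fin (d 0)) ℝ)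
    (lam : ℝ) (W : Params d (L + 1))
    (hb : ∀ (k : ℕ) (hk : k + 1 < L + 1), W ⟨k, Nat.lt_of_succ_lt hk⟩ *
      (W ⟨k, Nat.lt_of_succ_lt hk⟩)ᵀ = (W ⟨k + 1, hk⟩)ᵀ * W ⟨k + 1, hk⟩) :
    loss M lam W = ‖M‖ ^ 2 - 2 * (M * (endToEnd d (L + 1) W)ᵀ).trace +
      (endToEnd d (L + 1) W * (endToEnd d (L + 1) W)ᵀ).trace +
      lam * (W (Fin.last L) * (W (Fin.last L))ᵀ).trace := by
  have hL0 : ((L + 1 : ℕ) : ℝ) ≠ 0 := by positivity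
  simp only [loss, frobenius_norm_sub_sq, norm_sq_eq_of_balanced d L W hb, Finset.sum_const,
    Finset.card_univ, Fintype.card_fin, nsmul_eq_mul, ← mul_assoc, div_mul_cancel₀ lam hL0]

end Loss

/-! ### Spectral bounds and the scalar inequality -/

theorem norm_toEuclideanLin_le {m n : ℕ} (hm : 0 < m) (M : Matrix (Fin m) (Fin n) ℝ)
    (v : EuclideanSpace ℝ (Fin n)) : ‖Matrix.toEuclideanLin M v‖ ≤ ‖sigma M‖ * ‖v‖ := by
  set T := Matrix.toEuclideanLin M with hT
  have hn : Module.finrank ℝ (EuclideanSpace ℝ (Fin n)) = n := by simp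
  have hsym := T.isSymmetric_adjoint_comp_self
  have hle : ∀ i : Fin n, hsym.eigenvalues hn i ≤ ‖sigma M‖ ^ 2 := by
    intro i
    rw [← T.sq_singularValues_fin hn i]
    -- The maximum norm sees the top singular value only if index `0` exists in `Fin (min m n)`.
    have hpos : 0 < min m n := by have := i.isLt; omega
    have h1 : T.singularValues i ≤ T.singularValues 0 := T.singularValues_antitone (Nat.zero_le _)
    have h2 : T.singularValues 0 ≤ ‖sigma M‖ :=
      (le_abs_self _).trans (norm_le_pi_norm (sigma M) ⟨0, hpos⟩)
    have := T.singularValues_nonneg i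
    gcongr
    exact h1.trans h2
  refine abs_le_of_sq_le_sq' ?_ (by positivity) |>.2
  let b := hsym.eigenvectorBasis hn
  have hadj : ‖T v‖ ^ 2 = ∑ i, hsym.eigenvalues hn i * inner ℝ (b i) v ^ 2 := by
    rw [← real_inner_self_eq_norm_sq, ← LinearMap.adjoint_inner_left, ← b.sum_inner_mul_inner]
    refine Finset.sum_congr rfl fun i _ => ?_
    have h1 : inner ℝ (T.adjoint (T v)) (b i) = hsym.eigenvalues hn i * inner ℝ (b i) v := by
      have := hsym v (b i)
      rw [LinearMap.comp_apply] at this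
      rw [this, hsym.apply_eigenvectorBasis hn i, real_inner_comm]
      simp [b, inner_smul_left]
    rw [h1]; ring
  rw [hadj, mul_pow, ← b.sum_sq_inner_right v, Finset.mul_sum]
  gcongr with i
  exact hle i

theorem trace_eq_sum_inner_toEuclideanLin {n : Type*} [Fintype n] [DecidableEq n] (B : Matrix n n ℝ)
    (b : OrthonormalBasis n ℝ (EuclideanSpace ℝ n)) :
    B.trace = ∑ j, inner ℝ (b j) (Matrix.toEuclideanLin B (b j)) := by
  rw [← LinearMap.trace_eq_sum_inner _ b]
  rw [Matrix.toEuclideanLin, Matrix.toLpLin_eq_toLin, LinearMap.trace_eq_matrix_trace ℝ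
    (PiLp.basisFun 2 ℝ n), LinearMap.toMatrix_toLin]

/-- The scalar form of the threshold on `lam`. -/
theorem scalar_pos {m lam q s : ℝ} (hm : 0 ≤ m) (hlam : 0 < lam) (hq1 : q ≤ 1)
    (h : (m / ((1 - q / 2) * (1 - q) ^ ((q - 1) / (2 - q)))) ^ (2 - q) < lam) (hs : 0 < s) :
    0 < s ^ 2 - 2 * m * s + lam * s ^ q := by
  suffices h : 2 * m < s + lam * s ^ (q - 1) by
    have e : lam * s ^ q = lam * s ^ (q - 1) * s := by
      rw [mul_assoc, ← Real.rpow_add_one hs.ne', sub_add_cancel]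
    rw [e]
    nlinarith [mul_lt_mul_of_pos_right h hs]
  rcases hq1.eq_or_lt with rfl | hq1
  -- At `q = 1` the real power `0 ^ 0` is `1`, and the threshold reads `2 * m < lam`.
  · norm_num at h ⊢
    linarith
  have h1 : 0 < 1 - q := by linarith
  have h2 : 0 < 2 - q := by linarith
  set c := (1 - q / 2) * (1 - q) ^ ((q - 1) / (2 - q)) with hc
  have hcpos : 0 < c := mul_pos (by linarith) (Real.rpow_pos_of_pos h1 _)
  have h3 : m < lam ^ (1 / (2 - q)) * c := by
    rw [← div_lt_iff₀ hcpos]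
    have := Real.rpow_lt_rpow (by positivity) h (one_div_pos.2 h2)
    rwa [← Real.rpow_mul (by positivity), mul_one_div_cancel h2.ne', Real.rpow_one] at this
  -- The weights make the powers of `s` cancel in the geometric mean, which is then the exact
  -- minimum of `s + lam * s ^ (q - 1)` over `s > 0`.
  have amgm := Real.geom_mean_le_arith_mean2_weighted (w₁ := (1 - q) / (2 - q))
    (w₂ := 1 / (2 - q)) (p₁ := s * ((2 - q) / (1 - q))) (p₂ := lam * s ^ (q - 1) * (2 - q))
    (by positivity) (by positivity) (by positivity) (by positivity) (by field_simp; ring)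
  have e1 : (1 - q) / (2 - q) * (s * ((2 - q) / (1 - q))) +
      1 / (2 - q) * (lam * s ^ (q - 1) * (2 - q)) = s + lam * s ^ (q - 1) := by
    field_simp
  have e2 : (s * ((2 - q) / (1 - q))) ^ ((1 - q) / (2 - q)) *
      (lam * s ^ (q - 1) * (2 - q)) ^ (1 / (2 - q)) = 2 * (lam ^ (1 / (2 - q)) * c) := by
    have hsum : (1 - q) / (2 - q) + 1 / (2 - q) = 1 := by field_simp; ring
    have a1 : s ^ ((1 - q) / (2 - q)) * (s ^ (q - 1)) ^ (1 / (2 - q)) = 1 := by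
      rw [← Real.rpow_mul hs.le, ← Real.rpow_add hs]
      convert Real.rpow_zero s using 2
      field_simp; ring
    have a2 : (2 - q) ^ ((1 - q) / (2 - q)) * (2 - q) ^ (1 / (2 - q)) = 2 - q := by
      rw [← Real.rpow_add h2, hsum, Real.rpow_one]
    have a3 : ((1 - q) ^ ((1 - q) / (2 - q)))⁻¹ = (1 - q) ^ ((q - 1) / (2 - q)) := by
      rw [← Real.rpow_neg h1.le]; congr 1; ring
    rw [Real.mul_rpow hs.le (by positivity), Real.div_rpow h2.le h1.le,
      Real.mul_rpow (by positivity) h2.le, Real.mul_rpow hlam.le (by positivity),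
      div_eq_mul_inv (_ ^ _), a3, hc]
    calc _ = (s ^ ((1 - q) / (2 - q)) * (s ^ (q - 1)) ^ (1 / (2 - q))) *
          ((2 - q) ^ ((1 - q) / (2 - q)) * (2 - q) ^ (1 / (2 - q))) * lam ^ (1 / (2 - q)) *
          (1 - q) ^ ((q - 1) / (2 - q)) := by ring
      _ = _ := by rw [a1, a2]; ring
  rw [e1, e2] at amgm
  linarith

/-- Cauchy–Schwarz on each basis vector suffices, since only the largest singular value of `M`
enters. -/
theorem trace_mul_transpose_le {m n : ℕ} (M X : Matrix (Fin m) (Fin n) ℝ)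
    (b : OrthonormalBasis (Fin m) ℝ (EuclideanSpace ℝ (Fin m))) :
    (M * Xᵀ).trace ≤ ∑ j, ‖sigma M‖ * ‖Matrix.toEuclideanLin Xᵀ (b j)‖ := by
  rw [trace_eq_sum_inner_toEuclideanLin _ b]
  refine Finset.sum_le_sum fun j _ => ?_
  have h : Matrix.toEuclideanLin (M * Xᵀ) (b j) =
      Matrix.toEuclideanLin M (Matrix.toEuclideanLin Xᵀ (b j)) := by
    simp [Matrix.toEuclideanLin]
  rw [h]
  calc _ ≤ ‖b j‖ * _ := real_inner_le_norm _ _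
    _ ≤ _ := by
      rw [b.norm_eq_one, one_mul]
      exact norm_toEuclideanLin_le j.pos M _

theorem norm_sq_toEuclideanLin_transpose {m n : Type*} [Fintype m] [Fintype n] [DecidableEq m]
    [DecidableEq n] (X : Matrix m n ℝ) (v : EuclideanSpace ℝ m) :
    ‖Matrix.toEuclideanLin Xᵀ v‖ ^ 2 = inner ℝ v (Matrix.toEuclideanLin (X * Xᵀ) v) := by
  have h : Matrix.toEuclideanLin (X * Xᵀ) v =
      Matrix.toEuclideanLin X (Matrix.toEuclideanLin Xᵀ v) := by
    simp [Matrix.toEuclideanLin]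
  have h2 := Matrix.toEuclideanLin_conjTranspose_eq_adjoint X
  rw [Matrix.conjTranspose_eq_transpose_of_trivial] at h2
  rw [h, ← LinearMap.adjoint_inner_left, ← h2, real_inner_self_eq_norm_sq]

theorem toEuclideanLin_pow_eigenvectorBasis {n : Type*} [Fintype n] [DecidableEq n]
    {A : Matrix n n ℝ} (hA : A.IsHermitian) (k : ℕ) (j : n) :
    Matrix.toEuclideanLin (A ^ k) (hA.eigenvectorBasis j) =
      hA.eigenvalues j ^ k • hA.eigenvectorBasis j := by
  induction k with
  | zero => simp [Matrix.toEuclideanLin]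
  | succ k ih =>
    have h1 : Matrix.toEuclideanLin A (hA.eigenvectorBasis j) =
        hA.eigenvalues j • hA.eigenvectorBasis j := by
      ext i; exact congrFun (hA.mulVec_eigenvectorBasis j) i
    have h2 : Matrix.toEuclideanLin (A ^ (k + 1)) (hA.eigenvectorBasis j) =
        Matrix.toEuclideanLin (A ^ k) (Matrix.toEuclideanLin A (hA.eigenvectorBasis j)) := by
      simp [Matrix.toEuclideanLin, pow_succ]
    rw [h2, h1, map_smul, ih, smul_smul, pow_succ']

end DeepMF

open DeepMF Matrix in
theorem mainTheorem4 (L : ℕ) (hL : 2 ≤ L) (d : ℕ → ℕ)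
    (hd : ∀ i ≤ L, min (d 0) (d L) ≤ d i)
    (M : Matrix (Fin (d L)) (Fin (d 0)) ℝ) (lam : ℝ) (hlam : 0 < lam)
    (q : ℝ) (hq : q = 2 / (L : ℝ))
    (hthreshold :
      (‖DeepMF.sigma M‖ / ((1 - q / 2) * (1 - q) ^ ((q - 1) / (2 - q)))) ^ (2 - q) < lam)
    (W : DeepMF.Params d L) (hW : W ∈ DeepMF.minimizers M lam) :
    DeepMF.endToEnd d L W = 0 := by
  obtain ⟨L, rfl⟩ : ∃ k, L = k + 1 := ⟨L - 1, by omega⟩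
  have hb := balanced_of_mem_minimizers hlam hW
  have hpow := endToEnd_mul_transpose_of_balanced d L W hb
  set X := endToEnd d (L + 1) W with hX
  set A := W (Fin.last L) * (W (Fin.last L))ᵀ with hAdef
  have hL0 : (0 : ℝ) < (L + 1 : ℕ) := by positivity
  have hL2 : (2 : ℝ) ≤ (L + 1 : ℕ) := by exact_mod_cast hL
  have hq1 : q ≤ 1 := by rw [hq, div_le_one hL0]; exact hL2
  have hpsd : A.PosSemidef := by
    simpa using Matrix.posSemidef_self_mul_conjTranspose (W (Fin.last L))
  have hA := hpsd.isHermitian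
  have ha := hpsd.eigenvalues_nonneg
  -- As `X * Xᵀ` is a power of `A`, these are the square roots of its eigenvalues, so no singular
  -- value decomposition of `X` is needed.
  let s : Fin (d (L + 1)) → ℝ := fun j => ‖Matrix.toEuclideanLin Xᵀ (hA.eigenvectorBasis j)‖
  have hinner : ∀ j, inner ℝ (hA.eigenvectorBasis j)
      (Matrix.toEuclideanLin (X * Xᵀ) (hA.eigenvectorBasis j)) = hA.eigenvalues j ^ (L + 1) := by
    intro j
    rw [hpow, toEuclideanLin_pow_eigenvectorBasis, inner_smul_right, real_inner_self_eq_norm_sq]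
    simp
  have hs : ∀ j, s j ^ 2 = hA.eigenvalues j ^ (L + 1) := fun j => by
    rw [← hinner, ← norm_sq_toEuclideanLin_transpose]
  have hs0 : ∀ j, 0 ≤ s j := fun j => norm_nonneg _
  have haq : ∀ j, hA.eigenvalues j = s j ^ q := by
    intro j
    have h : (s j ^ 2) ^ (1 / ((L + 1 : ℕ) : ℝ)) = hA.eigenvalues j := by
      rw [hs, one_div, Real.pow_rpow_inv_natCast (ha j) (by omega)]
    rw [← h, ← Real.rpow_natCast, ← Real.rpow_mul (hs0 j), hq]
    congr 1
    push_cast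
    ring
  have htr : (X * Xᵀ).trace = ∑ j, s j ^ 2 := by
    rw [trace_eq_sum_inner_toEuclideanLin _ hA.eigenvectorBasis]
    exact Finset.sum_congr rfl fun j _ => by rw [hinner, hs]
  have htrA : A.trace = ∑ j, s j ^ q := by
    rw [hA.trace_eq_sum_eigenvalues]
    exact Finset.sum_congr rfl fun j _ => by simp [← haq]
  have hle : ∑ j, (s j ^ 2 - 2 * ‖sigma M‖ * s j + lam * s j ^ q) ≤ 0 := by
    -- The competitor is the zero weight family, whose loss is `‖M‖ ^ 2`.
    have h := hW 0
    have hX' := trace_mul_transpose_le M X hA.eigenvectorBasis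
    rw [loss_zero, loss_eq_of_balanced M lam W hb, ← hX, ← hAdef, htr, htrA] at h
    simp only [Finset.sum_add_distrib, Finset.sum_sub_distrib, ← Finset.mul_sum] at hX' ⊢
    change _ ≤ _ * ∑ j, s j at hX'
    linarith
  have hnonneg : ∀ j, 0 ≤ s j ^ 2 - 2 * ‖sigma M‖ * s j + lam * s j ^ q := by
    intro j
    rcases (hs0 j).eq_or_lt with h | h
    · rw [← h]
      have := Real.rpow_nonneg le_rfl q
      simp only [ne_eq, OfNat.ofNat_ne_zero, not_false_eq_true, zero_pow, mul_zero, sub_zero, zero_add]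
      positivity
    · exact (scalar_pos (norm_nonneg _) hlam hq1 hthreshold h).le
  have hsz : ∀ j, s j = 0 := by
    intro j
    by_contra hne
    have hpos := scalar_pos (norm_nonneg _) hlam hq1 hthreshold ((hs0 j).lt_of_ne' hne)
    exact absurd hle (not_le.2 (Finset.sum_pos' (fun i _ => hnonneg i) ⟨j, Finset.mem_univ j, hpos⟩))
  have h0 : (X * Xᵀ).trace = 0 := by rw [htr]; simp [hsz]
  exact Matrix.trace_mul_conjTranspose_self_eq_zero_iff.1 (by simpa using h0)
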